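/- Let $M$ be a smooth (Hausdorff) manifold of dimension $2n+1$ with a para-Sasakian structure $(\phi,\zeta,\eta,g)$. That is, $\phi$ is a smooth $(1,1)$-tensor field, $\zeta$ a smooth vector field, $\eta$ a smooth one-form and $g$ a smooth semi-Riemannian metric on $M$ such that - $\phi^2=I-\eta\otimes\zeta$, $\eta(\zeta)=1$, and at each point the eigenspaces of $\phi|_{\ker\eta}$ for the eigenvalues $+1$ and $-1$ both have dimension $n$; - $g(\phi X,\phi Y)=-g(X,Y)+\eta(X)\eta(Y)$ for all vector fields $X,Y$; - $d\eta(X,Y)=g(X,\phi Y)$, where $d\eta(X,Y)=\tfrac12\big(X\eta(Y)-Y\eta(X)-\eta([X,Y])\big)$; - the structure is normal: $[\phi,\phi](X,Y)-2\,d\eta(X,Y)\,\zeta=0$, where $[\phi,\phi](X,Y)=\phi^2[X,Y]+[\phi X,\phi Y]-\phi[\phi X,Y]-\phi[X,\phi Y]$. Let $S$ be the Ricci tensor of $g$, $S(Y,Z)=\operatorname{tr}(X\mapsto R(X,Y)Z)$ with $R(X,Y)Z=\nabla_X\nabla_YZ-\nabla_Y\nabla_XZ-\nabla_{[X,Y]}Z$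 for the Levi-Civita connection $\nabla$, and let $r$ be the scalar curvature. Suppose that $(g,\zeta,\lambda,\alpha,\beta)$ is a proper $h$-almost Ricci-Yamabe soliton on $M$ with potential field $\zeta$: $h,\lambda:M\to\mathbb{R}$ are smooth functions, $\alpha,\beta\in\mathbb{R}$ with $\alpha\neq0$ and $\alpha\neq1$, and $$\frac h2\,\pounds_\zeta g+\alpha S+\Big(\lambda-\frac\beta2 r\Big)g=0 .$$ Then $M$ is an Einstein manifold, with $$S=-2n\,g,\qquad\text{and}\qquad \beta r=2\lambda-4n\alpha\ \text{ on } M.$$ -/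

import Mathlib

open Bundle Module
open scoped Manifold ContDiff

noncomputable section

namespace ParaGeom

variable {d : ℕ} {M : Type*} [TopologicalSpace M]
  [ChartedSpace (EuclideanSpace ℝ (Fin d)) M]

/-- Vector fields (no regularity imposed) on the `d`-dimensional manifold `M`. -/
abbrev VField (d : ℕ) (M : Type*) [TopologicalSpace M]
    [ChartedSpace (EuclideanSpace ℝ (Fin d)) M] : Type _ :=
  (x : M) → TangentSpace (𝓡 d) x

/-- The vector field `X` is smooth, that is `X ∈ χ(M)`. -/
def IsSmoothField [IsManifold (𝓡 d) ∞ M] (X : VField d M) : Prop :=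
  ContMDiff (𝓡 d) ((𝓡 d).prod 𝓘(ℝ, EuclideanSpace ℝ (Fin d))) ∞
    (fun x ↦ TotalSpace.mk' (EuclideanSpace ℝ (Fin d)) x (X x))

/-- The derivative `X f` of a function along a vector field. -/
def dirDeriv (X : VField d M) (f : M → ℝ) (x : M) : ℝ :=
  mvfderiv (𝓡 d) f x (X x)

/-- The Lie bracket `[X, Y]`. -/
abbrev bracket (X Y : VField d M) : VField d M :=
  VectorField.mlieBracket (𝓡 d) X Y

/-- A smooth semi-Riemannian metric on `M`: a smooth field of symmetric nondegenerate
bilinear forms on the tangent spaces. -/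
structure SemiRiemannianMetric (d : ℕ) (M : Type*) [TopologicalSpace M]
    [ChartedSpace (EuclideanSpace ℝ (Fin d)) M] [IsManifold (𝓡 d) ∞ M] where
  /-- The scalar product on each tangent space. -/
  inner (x : M) : TangentSpace (𝓡 d) x →L[ℝ] TangentSpace (𝓡 d) x →L[ℝ] ℝ
  symm (x : M) (v w : TangentSpace (𝓡 d) x) : inner x v w = inner x w v
  nondeg (x : M) (v : TangentSpace (𝓡 d) x) : (∀ w, inner x v w = 0) → v = 0
  contMDiff : ContMDiff (𝓡 d)
    ((𝓡 d).prod 𝓘(ℝ, EuclideanSpace ℝ (Fin d) →L[ℝ] EuclideanSpace ℝ (Fin d) →L[ℝ] ℝ)) ∞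
    (fun x ↦ TotalSpace.mk'
      (EuclideanSpace ℝ (Fin d) →L[ℝ] EuclideanSpace ℝ (Fin d) →L[ℝ] ℝ) x (inner x))

section Frame

variable [IsManifold (𝓡 d) ∞ M]

/-- The coordinate vector field `∂ᵢ` of the preferred chart around `x`
(extended by `0` outside of the domain of the chart). -/
def coordField (x : M) (i : Fin d) : VField d M :=
  (trivializationAt (EuclideanSpace ℝ (Fin d)) (TangentSpace (𝓡 d) : M → Type _) x).localFrame
    (EuclideanSpace.basisFun (Fin d) ℝ).toBasis i

/-- The basis `∂₁|ₓ, …, ∂_d|ₓ` of the tangent space at `x`. -/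
def coordBasis (x : M) : Basis (Fin d) ℝ (TangentSpace (𝓡 d) x) :=
  (trivializationAt (EuclideanSpace ℝ (Fin d)) (TangentSpace (𝓡 d) : M → Type _) x).basisAt
    (EuclideanSpace.basisFun (Fin d) ℝ).toBasis
    (FiberBundle.mem_baseSet_trivializationAt _ _ x)

end Frame

namespace SemiRiemannianMetric

variable [IsManifold (𝓡 d) ∞ M] (g : SemiRiemannianMetric d M)

/-- The function `g(X, Y)`. -/
def pair (X Y : VField d M) (x : M) : ℝ := g.inner x (X x) (Y x)

/-- The metric at `x` as a bilinear form. -/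
def bilin (x : M) : LinearMap.BilinForm ℝ (TangentSpace (𝓡 d) x) :=
  LinearMap.mk₂ ℝ (fun v w ↦ g.inner x v w) (by simp) (by simp) (by simp) (by simp)

lemma bilin_apply (x : M) (v w : TangentSpace (𝓡 d) x) : g.bilin x v w = g.inner x v w := rfl

lemma bilin_nondegenerate (x : M) : (g.bilin x).Nondegenerate :=
  ⟨fun v hv ↦ g.nondeg x v hv, fun v hv ↦ g.nondeg x v fun w ↦ by
    rw [g.symm]; exact hv w⟩

/-- The basis of the tangent space at `x` that is `g`-dual to the coordinate basis:
`g (dualFrame x i) (∂ⱼ|ₓ) = δᵢⱼ`, that is `dualFrame x i = ∑ⱼ gⁱʲ ∂ⱼ|ₓ`. -/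
def dualFrame (x : M) : Basis (Fin d) ℝ (TangentSpace (𝓡 d) x) :=
  (g.bilin x).dualBasis (g.bilin_nondegenerate x) (coordBasis x)

/-- The right-hand side of the Koszul formula for `g(∇_X Y, Z)`. -/
def koszul (X Y Z : VField d M) (x : M) : ℝ :=
  (1 / 2) * (dirDeriv X (g.pair Y Z) x + dirDeriv Y (g.pair X Z) x - dirDeriv Z (g.pair X Y) x
    + g.pair (bracket X Y) Z x - g.pair (bracket X Z) Y x - g.pair (bracket Y Z) X x)

/-- The Levi-Civita connection `∇_X Y` of `g`: at `x` it is the vector whose scalar product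
with each coordinate vector `∂ₖ` is the one that the Koszul formula prescribes. -/
def nabla (X Y : VField d M) : VField d M :=
  fun x ↦ ∑ k, g.koszul X Y (coordField x k) x • g.dualFrame x k

/-- The curvature `R(X, Y)Z = ∇_X ∇_Y Z - ∇_Y ∇_X Z - ∇_{[X,Y]} Z`. -/
def curvature (X Y Z : VField d M) : VField d M :=
  g.nabla X (g.nabla Y Z) - g.nabla Y (g.nabla X Z) - g.nabla (bracket X Y) Z

/-- The Ricci tensor `S(Y, Z)`: the trace of `W ↦ R(W, Y)Z`. -/
def ricci (Y Z : VField d M) (x : M) : ℝ :=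
  ∑ i, (coordBasis x).repr (g.curvature (coordField x i) Y Z x) i

/-- The scalar curvature `r = ∑ᵢⱼ gⁱʲ S(∂ᵢ, ∂ⱼ)`, where `gⁱʲ` is the scalar product of the
`i`-th and the `j`-th vector of the `g`-dual frame. -/
def scalar (x : M) : ℝ :=
  ∑ i, ∑ j, g.inner x (g.dualFrame x i) (g.dualFrame x j) *
    g.ricci (coordField x i) (coordField x j) x

/-- The Lie derivative `(£_V g)(X, Y)`. -/
def lieDeriv (V X Y : VField d M) (x : M) : ℝ :=
  dirDeriv V (g.pair X Y) x - g.pair (bracket V X) Y x - g.pair X (bracket V Y) x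

/-- `g` is an Einstein metric with Einstein constant `c`: `S = c g`. -/
def IsEinsteinWith (c : ℝ) : Prop :=
  ∀ X Y : VField d M, IsSmoothField X → IsSmoothField Y →
    ∀ x, g.ricci X Y x = c * g.pair X Y x

/-- `(g, V, lam, α, β)` is an `h`-almost Ricci-Yamabe soliton:
`(h/2) £_V g + α S + (lam - (β/2) r) g = 0`, where `h` and `lam` are smooth functions
and `α`, `β` are real constants. -/
structure IsHAlmostRicciYamabeSoliton (V : VField d M) (h lam : M → ℝ) (α β : ℝ) : Prop where
  smooth_field : IsSmoothField V
  smooth_h : ContMDiff (𝓡 d) 𝓘(ℝ, ℝ) ∞ h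
  smooth_lam : ContMDiff (𝓡 d) 𝓘(ℝ, ℝ) ∞ lam
  soliton_eq : ∀ X Y : VField d M, IsSmoothField X → IsSmoothField Y → ∀ x,
    h x / 2 * g.lieDeriv V X Y x + α * g.ricci X Y x
      + (lam x - β / 2 * g.scalar x) * g.pair X Y x = 0

/-- A proper `h`-almost Ricci-Yamabe soliton: one with `α ≠ 0, 1`. -/
structure IsProperHAlmostRicciYamabeSoliton (V : VField d M) (h lam : M → ℝ) (α β : ℝ) : Prop
    extends g.IsHAlmostRicciYamabeSoliton V h lam α β where
  ne_zero : α ≠ 0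
  ne_one : α ≠ 1

end SemiRiemannianMetric

/-- An almost paracontact structure `(φ, ζ, η)` on a manifold of dimension `2n+1`. -/
structure AlmostParacontact (n : ℕ) (M : Type*) [TopologicalSpace M]
    [ChartedSpace (EuclideanSpace ℝ (Fin (2 * n + 1))) M]
    [IsManifold (𝓡 (2 * n + 1)) ∞ M] where
  /-- The (1,1)-tensor field `φ`. -/
  φ (x : M) : TangentSpace (𝓡 (2 * n + 1)) x →L[ℝ] TangentSpace (𝓡 (2 * n + 1)) x
  /-- The characteristic vector field `ζ`. -/
  ζ : VField (2 * n + 1) M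
  /-- The one-form `η`. -/
  η (x : M) : TangentSpace (𝓡 (2 * n + 1)) x →L[ℝ] ℝ
  smooth_φ : ContMDiff (𝓡 (2 * n + 1))
    ((𝓡 (2 * n + 1)).prod 𝓘(ℝ, EuclideanSpace ℝ (Fin (2 * n + 1)) →L[ℝ]
      EuclideanSpace ℝ (Fin (2 * n + 1)))) ∞
    (fun x ↦ TotalSpace.mk' (EuclideanSpace ℝ (Fin (2 * n + 1)) →L[ℝ]
      EuclideanSpace ℝ (Fin (2 * n + 1))) x (φ x))
  smooth_ζ : IsSmoothField ζ
  smooth_η : ContMDiff (𝓡 (2 * n + 1))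
    ((𝓡 (2 * n + 1)).prod 𝓘(ℝ, EuclideanSpace ℝ (Fin (2 * n + 1)) →L[ℝ] ℝ)) ∞
    (fun x ↦ TotalSpace.mk' (EuclideanSpace ℝ (Fin (2 * n + 1)) →L[ℝ] ℝ) x (η x))
  φ_sq (x : M) (v : TangentSpace (𝓡 (2 * n + 1)) x) : φ x (φ x v) = v - η x v • ζ x
  η_ζ (x : M) : η x (ζ x) = 1
  /-- The `+1`-eigendistribution of `φ` on `ker η` has dimension `n`. -/
  finrank_pos (x : M) : finrank ℝ
    ↥(Module.End.eigenspace (φ x).toLinearMap 1 ⊓ LinearMap.ker (η x).toLinearMap) = n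
  /-- The `-1`-eigendistribution of `φ` on `ker η` has dimension `n`. -/
  finrank_neg (x : M) : finrank ℝ
    ↥(Module.End.eigenspace (φ x).toLinearMap (-1) ⊓ LinearMap.ker (η x).toLinearMap) = n

namespace AlmostParacontact

variable {n : ℕ} {N : Type*} [TopologicalSpace N]
  [ChartedSpace (EuclideanSpace ℝ (Fin (2 * n + 1))) N]
  [IsManifold (𝓡 (2 * n + 1)) ∞ N] (P : AlmostParacontact n N)

/-- The vector field `φ X`. -/
def phi (X : VField (2 * n + 1) N) : VField (2 * n + 1) N := fun x ↦ P.φ x (X x)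

/-- The function `η(X)`. -/
def eta (X : VField (2 * n + 1) N) (x : N) : ℝ := P.η x (X x)

/-- The exterior derivative, with the normalization that is used in paracontact geometry:
`dη(X, Y) = ½ (X η(Y) - Y η(X) - η([X, Y]))`. -/
def dEta (X Y : VField (2 * n + 1) N) (x : N) : ℝ :=
  (1 / 2) * (dirDeriv X (P.eta Y) x - dirDeriv Y (P.eta X) x - P.eta (bracket X Y) x)

/-- The Nijenhuis torsion of `φ`:
`[φ, φ](X, Y) = φ²[X, Y] + [φX, φY] - φ[φX, Y] - φ[X, φY]`. -/
def torsion (X Y : VField (2 * n + 1) N) : VField (2 * n + 1) N :=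
  P.phi (P.phi (bracket X Y)) + bracket (P.phi X) (P.phi Y)
    - P.phi (bracket (P.phi X) Y) - P.phi (bracket X (P.phi Y))

/-- The structure is normal: the Nijenhuis tensor `[φ, φ] - 2 dη ⊗ ζ` of the almost
paracontact structure vanishes. -/
def IsNormal : Prop :=
  ∀ X Y : VField (2 * n + 1) N, IsSmoothField X → IsSmoothField Y → ∀ x,
    P.torsion X Y x - (2 * P.dEta X Y x) • P.ζ x = 0

/-- `(φ, ζ, η, g)` is an almost paracontact metric structure. -/
def IsMetric (g : SemiRiemannianMetric (2 * n + 1) N) : Prop :=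
  ∀ (x : N) (v w : TangentSpace (𝓡 (2 * n + 1)) x),
    g.inner x (P.φ x v) (P.φ x w) = - g.inner x v w + P.η x v * P.η x w

/-- `(φ, ζ, η, g)` is a paracontact metric structure: moreover `dη(X, Y) = g(X, φY)`. -/
structure IsParacontactMetric (g : SemiRiemannianMetric (2 * n + 1) N) : Prop where
  isMetric : P.IsMetric g
  dEta_eq : ∀ X Y : VField (2 * n + 1) N, IsSmoothField X → IsSmoothField Y → ∀ x,
    P.dEta X Y x = g.pair X (P.phi Y) x

/-- A para-Sasakian structure is a normal paracontact metric structure. -/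
structure IsParaSasakian (g : SemiRiemannianMetric (2 * n + 1) N) : Prop
    extends P.IsParacontactMetric g where
  isNormal : P.IsNormal

end AlmostParacontact

end ParaGeom

end

noncomputable section

namespace ParaGeom

open Filter Topology

section Fields

variable {d : ℕ} {M : Type*} [TopologicalSpace M]
  [ChartedSpace (EuclideanSpace ℝ (Fin d)) M]

lemma dirDeriv_congr {X X' : VField d M} {f f' : M → ℝ} {x : M} (hX : X x = X' x)
    (hf : f =ᶠ[𝓝 x] f') : dirDeriv X f x = dirDeriv X' f' x := by
  simp only [dirDeriv, mvfderiv, hX]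
  rw [ContinuousLinearMap.comp_apply, ContinuousLinearMap.comp_apply, hf.mfderiv_eq]
  rfl

lemma dirDeriv_const (X : VField d M) (c : ℝ) (x : M) : dirDeriv X (fun _ ↦ c) x = 0 := by
  simp [dirDeriv, mvfderiv_const]

lemma dirDeriv_zero_left (f : M → ℝ) (x : M) : dirDeriv (0 : VField d M) f x = 0 := by
  simp [dirDeriv]

lemma dirDeriv_add (X : VField d M) {f f' : M → ℝ} (hf : ContMDiff (𝓡 d) 𝓘(ℝ, ℝ) ∞ f)
    (hf' : ContMDiff (𝓡 d) 𝓘(ℝ, ℝ) ∞ f') (x : M) :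
    dirDeriv X (fun y ↦ f y + f' y) x = dirDeriv X f x + dirDeriv X f' x := by
  have := mvfderiv_add (I := 𝓡 d) (hf.mdifferentiableAt (x := x) (by simp))
    (hf'.mdifferentiableAt (x := x) (by simp))
  simpa [dirDeriv] using! congrArg (fun L ↦ L (X x)) this

lemma dirDeriv_sub (X : VField d M) {f f' : M → ℝ} (hf : ContMDiff (𝓡 d) 𝓘(ℝ, ℝ) ∞ f)
    (hf' : ContMDiff (𝓡 d) 𝓘(ℝ, ℝ) ∞ f') (x : M) :
    dirDeriv X (fun y ↦ f y - f' y) x = dirDeriv X f x - dirDeriv X f' x := by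
  have := mvfderiv_sub (I := 𝓡 d) (hf.mdifferentiableAt (x := x) (by simp))
    (hf'.mdifferentiableAt (x := x) (by simp))
  simpa [dirDeriv] using! congrArg (fun L ↦ L (X x)) this

lemma dirDeriv_mul (X : VField d M) {f f' : M → ℝ} (hf : ContMDiff (𝓡 d) 𝓘(ℝ, ℝ) ∞ f)
    (hf' : ContMDiff (𝓡 d) 𝓘(ℝ, ℝ) ∞ f') (x : M) :
    dirDeriv X (fun y ↦ f y * f' y) x = f x * dirDeriv X f' x + f' x * dirDeriv X f x := by
  have := mvfderiv_mul (I := 𝓡 d) (hf.mdifferentiableAt (x := x) (by simp))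
    (hf'.mdifferentiableAt (x := x) (by simp))
  simpa [dirDeriv] using! congrArg (fun L ↦ L (X x)) this

lemma bracket_swap (X Y : VField d M) (x : M) : bracket X Y x = - bracket Y X x :=
  VectorField.mlieBracket_swap_apply

variable [IsManifold (𝓡 d) ∞ M]

namespace IsSmoothField

variable {X Y Z : VField d M} {f : M → ℝ}

lemma mdiffAt (hX : IsSmoothField X) (x : M) :
    MDifferentiableAt (𝓡 d) ((𝓡 d).prod 𝓘(ℝ, EuclideanSpace ℝ (Fin d)))
      (fun x ↦ TotalSpace.mk' (EuclideanSpace ℝ (Fin d)) x (X x)) x :=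
  ContMDiff.mdifferentiableAt hX (by simp)

lemma bracket (hX : IsSmoothField X) (hY : IsSmoothField Y) :
    IsSmoothField (bracket X Y) := by
  have : IsManifold (𝓡 d) ((⊤ : ℕ∞) + 1) M := by simpa using ‹IsManifold (𝓡 d) ∞ M›
  have : IsManifold (𝓡 d) (minSmoothness ℝ 2) M := by
    simp only [minSmoothness_of_isRCLikeNormedField]; infer_instance
  exact ContDiff.mlieBracket_vectorField (m := ⊤) (n := ⊤) hX hY (by simp)

lemma smul (hf : ContMDiff (𝓡 d) 𝓘(ℝ, ℝ) ∞ f) (hX : IsSmoothField X) :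
    IsSmoothField (f • X) :=
  ContMDiff.smul_section hf hX

lemma neg (hX : IsSmoothField X) : IsSmoothField (-X) :=
  ContMDiff.neg_section hX

end IsSmoothField

variable {X Y Z : VField d M} {f : M → ℝ}

lemma bracket_smul (hf : ContMDiff (𝓡 d) 𝓘(ℝ, ℝ) ∞ f) (hY : IsSmoothField Y) (x : M) :
    bracket X (f • Y) x = dirDeriv X f x • Y x + f x • bracket X Y x := by
  exact VectorField.mlieBracket_smul_right (hf.mdifferentiableAt (by simp)) (hY.mdiffAt x)

lemma bracket_add (hY : IsSmoothField Y) (hZ : IsSmoothField Z) (x : M) :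
    bracket X (Y + Z) x = bracket X Y x + bracket X Z x := by
  exact VectorField.mlieBracket_add_right (hY.mdiffAt x) (hZ.mdiffAt x)

lemma bracket_neg (hY : IsSmoothField Y) (x : M) :
    bracket X (-Y) x = - bracket X Y x := by
  have := VectorField.mlieBracket_const_smul_right (I := 𝓡 d) (c := (-1 : ℝ)) (V := X)
    (hY.mdiffAt x)
  simpa using this

lemma bracket_jacobi (hX : IsSmoothField X) (hY : IsSmoothField Y) (hZ : IsSmoothField Z) (x : M) :
    bracket X (bracket Y Z) x = bracket (bracket X Y) Z x + bracket Y (bracket X Z) x := by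
  have : IsManifold (𝓡 d) (minSmoothness ℝ 3) M := by
    simp only [minSmoothness_of_isRCLikeNormedField]; infer_instance
  have h2 : minSmoothness ℝ 2 ≤ ∞ := by
    simp only [minSmoothness_of_isRCLikeNormedField]; exact ENat.LEInfty.out
  exact VectorField.leibniz_identity_mlieBracket_apply
    ((hX x).of_le h2) ((hY x).of_le h2) ((hZ x).of_le h2)

lemma exists_smooth_eventuallyEq_coordField [T2Space M] (x : M) (i : Fin d) :
    ∃ X : VField d M, IsSmoothField X ∧ X =ᶠ[𝓝 x] coordField x i := by
  let e := trivializationAt (EuclideanSpace ℝ (Fin d)) (TangentSpace (𝓡 d) : M → Type _) x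
  obtain ⟨b⟩ : Nonempty (SmoothBumpFunction (𝓡 d) x) := inferInstance
  refine ⟨(b : M → ℝ) • coordField x i, ?_, ?_⟩
  · refine ContMDiffOn.smul_section_of_tsupport (u := e.baseSet) b.contMDiff.contMDiffOn
      e.open_baseSet ?_ ?_
    · exact b.tsupport_subset_chartAt_source
    · exact e.contMDiffOn_localFrame_baseSet ∞ _ i
  · filter_upwards [b.eventuallyEq_one] with y hy
    simp only [Pi.smul_apply', hy, Pi.one_apply, one_smul]
    rfl

lemma coordField_self (x : M) (i : Fin d) : coordField x i x = coordBasis x i :=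
  Trivialization.localFrame_apply_of_mem_baseSet _ _ _

end Fields

namespace SemiRiemannianMetric

variable {d : ℕ} {M : Type*} [TopologicalSpace M]
  [ChartedSpace (EuclideanSpace ℝ (Fin d)) M] [IsManifold (𝓡 d) ∞ M]
  (g : SemiRiemannianMetric d M) {X X' Y Y' Z Z' : VField d M} {x : M}

lemma pair_congr (hX : X =ᶠ[𝓝 x] X') (hY : Y =ᶠ[𝓝 x] Y') : g.pair X Y =ᶠ[𝓝 x] g.pair X' Y' := by
  filter_upwards [hX, hY] with y h1 h2
  simp [pair, h1, h2]

lemma koszul_congr (hX : X =ᶠ[𝓝 x] X') (hY : Y =ᶠ[𝓝 x] Y') (hZ : Z =ᶠ[𝓝 x] Z') :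
    g.koszul X Y Z x = g.koszul X' Y' Z' x := by
  unfold koszul
  rw [dirDeriv_congr hX.eq_of_nhds (g.pair_congr hY hZ),
    dirDeriv_congr hY.eq_of_nhds (g.pair_congr hX hZ),
    dirDeriv_congr hZ.eq_of_nhds (g.pair_congr hX hY),
    (g.pair_congr (hX.mlieBracket_vectorField hY) hZ).eq_of_nhds,
    (g.pair_congr (hX.mlieBracket_vectorField hZ) hY).eq_of_nhds,
    (g.pair_congr (hY.mlieBracket_vectorField hZ) hX).eq_of_nhds]

lemma nabla_congr (hX : X =ᶠ[𝓝 x] X') (hY : Y =ᶠ[𝓝 x] Y') : g.nabla X Y x = g.nabla X' Y' x := by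
  unfold nabla
  exact Finset.sum_congr rfl fun k _ ↦ by
    rw [g.koszul_congr hX hY (EventuallyEq.refl _ (coordField x k))]

lemma nabla_eventuallyEq (hX : X =ᶠ[𝓝 x] X') (hY : Y =ᶠ[𝓝 x] Y') :
    g.nabla X Y =ᶠ[𝓝 x] g.nabla X' Y' := by
  filter_upwards [hX.eventuallyEq_nhds, hY.eventuallyEq_nhds] with y h1 h2
  exact g.nabla_congr h1 h2

lemma curvature_congr (hX : X =ᶠ[𝓝 x] X') (hY : Y =ᶠ[𝓝 x] Y') (hZ : Z =ᶠ[𝓝 x] Z') :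
    g.curvature X Y Z x = g.curvature X' Y' Z' x := by
  simp only [curvature, Pi.sub_apply]
  rw [g.nabla_congr hX (g.nabla_eventuallyEq hY hZ), g.nabla_congr hY (g.nabla_eventuallyEq hX hZ),
    g.nabla_congr (hX.mlieBracket_vectorField hY) hZ]

lemma inner_nabla_coordBasis (X Y : VField d M) (x : M) (k : Fin d) :
    g.inner x (g.nabla X Y x) (coordBasis x k) = g.koszul X Y (coordField x k) x := by
  have h (j : Fin d) : g.inner x (g.dualFrame x j) (coordBasis x k) = if k = j then 1 else 0 :=
    (g.bilin x).apply_dualBasis_left (g.bilin_nondegenerate x) (coordBasis x) j k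
  simp [nabla, h]

/-- A vector is `∇_X Y` if its scalar products with smooth fields are given by the
Koszul formula. -/
lemma nabla_eq_of_koszul [T2Space M] {w : TangentSpace (𝓡 d) x}
    (h : ∀ Z : VField d M, IsSmoothField Z → g.koszul X Y Z x = g.inner x w (Z x)) :
    g.nabla X Y x = w := by
  rw [← sub_eq_zero]
  apply g.nondeg x
  suffices H : (g.inner x (g.nabla X Y x - w)).toLinearMap = 0 from
    fun v ↦ LinearMap.congr_fun H v
  refine (coordBasis x).ext fun k ↦ ?_
  obtain ⟨Z, hZ, hZk⟩ := exists_smooth_eventuallyEq_coordField x k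
  have h1 := h Z hZ
  rw [g.koszul_congr (EventuallyEq.refl _ X) (EventuallyEq.refl _ Y) hZk, hZk.eq_of_nhds, coordField_self] at h1
  simp [inner_nabla_coordBasis, h1]

lemma nabla_zero_right (X : VField d M) : g.nabla X 0 = 0 := by
  funext x
  have h1 (Z : VField d M) : g.pair 0 Z = fun _ ↦ 0 := by funext y; simp [pair]
  have h2 (Z : VField d M) : g.pair Z 0 = fun _ ↦ 0 := by funext y; simp [pair]
  simp [nabla, koszul, bracket, h1, h2, dirDeriv_const, dirDeriv_zero_left]

lemma koszul_eq_of_torsion_free (X Y Z : VField d M) (x : M) :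
    g.koszul X Y Z x = g.koszul Y X Z x + g.inner x (bracket X Y x) (Z x) := by
  have h1 : g.pair X Y = g.pair Y X := by funext y; exact g.symm ..
  have h2 : g.pair (bracket Y X) Z x = - g.pair (bracket X Y) Z x := by
    simp [pair, bracket_swap Y X x]
  simp only [koszul, h1, h2]
  simp only [pair]
  ring

lemma nabla_eq_add_bracket [T2Space M] (X Y : VField d M) (x : M) :
    g.nabla X Y x = g.nabla Y X x + bracket X Y x := by
  rw [← sub_eq_zero]
  apply g.nondeg x
  suffices H : (g.inner x (g.nabla X Y x - (g.nabla Y X x + bracket X Y x))).toLinearMap = 0 from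
    fun v ↦ LinearMap.congr_fun H v
  refine (coordBasis x).ext fun k ↦ ?_
  simp [inner_nabla_coordBasis, g.koszul_eq_of_torsion_free X Y, coordField_self]

end SemiRiemannianMetric

namespace AlmostParacontact

variable {n : ℕ} {M : Type*} [TopologicalSpace M]
  [ChartedSpace (EuclideanSpace ℝ (Fin (2 * n + 1))) M]
  [IsManifold (𝓡 (2 * n + 1)) ∞ M] (P : AlmostParacontact n M)
  {X Y : VField (2 * n + 1) M} {f : M → ℝ} {x : M}

lemma ζ_ne_zero (x : M) : P.ζ x ≠ 0 := fun h ↦ by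
  have := P.η_ζ x
  simp [h] at this

lemma φ_ζ (x : M) : P.φ x (P.ζ x) = 0 := by
  have h1 : P.φ x (P.φ x (P.ζ x)) = 0 := by simp [P.φ_sq, P.η_ζ]
  have h2 := P.φ_sq x (P.φ x (P.ζ x))
  rw [h1, map_zero, eq_comm, sub_eq_zero] at h2
  generalize P.η x (P.φ x (P.ζ x)) = c at h2
  rw [h2, map_smul, h2, smul_smul, smul_eq_zero, mul_self_eq_zero] at h1
  rw [h2, h1.resolve_right (P.ζ_ne_zero x), zero_smul]

lemma η_φ (x : M) (v : TangentSpace (𝓡 (2 * n + 1)) x) : P.η x (P.φ x v) = 0 := by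
  have h : P.φ x (P.φ x (P.φ x v)) = _ := P.φ_sq x (P.φ x v)
  rw [P.φ_sq x v, map_sub, map_smul, φ_ζ, smul_zero, sub_zero, eq_comm, sub_eq_self,
    smul_eq_zero] at h
  exact h.resolve_right (P.ζ_ne_zero x)

lemma phi_ζ : P.phi P.ζ = 0 := funext P.φ_ζ

lemma eta_phi (X : VField (2 * n + 1) M) : P.eta (P.phi X) = fun _ ↦ 0 :=
  funext fun x ↦ P.η_φ x (X x)

lemma eta_ζ : P.eta P.ζ = fun _ ↦ 1 := funext P.η_ζ

lemma phi_smooth (hX : IsSmoothField X) : IsSmoothField (P.phi X) := fun x ↦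
  ContMDiffAt.clm_bundle_apply (F₁ := EuclideanSpace ℝ (Fin (2 * n + 1)))
    (F₂ := EuclideanSpace ℝ (Fin (2 * n + 1))) (b := id) (P.smooth_φ x) (hX x)

lemma eta_contMDiff (hX : IsSmoothField X) :
    ContMDiff (𝓡 (2 * n + 1)) 𝓘(ℝ, ℝ) ∞ (P.eta X) := by
  intro x
  have := ContMDiffAt.clm_bundle_apply (F₁ := EuclideanSpace ℝ (Fin (2 * n + 1)))
    (F₂ := ℝ) (E₂ := fun _ : M ↦ ℝ) (b := id) (P.smooth_η x) (hX x)
  exact (contMDiffAt_section _).1 this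

include P in
lemma dirDeriv_contMDiff (hX : IsSmoothField X) (hf : ContMDiff (𝓡 (2 * n + 1)) 𝓘(ℝ, ℝ) ∞ f) :
    ContMDiff (𝓡 (2 * n + 1)) 𝓘(ℝ, ℝ) ∞ (dirDeriv X f) := by
  have h : dirDeriv X f = fun x ↦
      P.eta (bracket X (f • P.ζ)) x - f x * P.eta (bracket X P.ζ) x := by
    funext x
    simp [eta, bracket_smul hf P.smooth_ζ, P.η_ζ]
  rw [h]
  exact (P.eta_contMDiff (hX.bracket (P.smooth_ζ.smul hf))).sub
    (hf.mul (P.eta_contMDiff (hX.bracket P.smooth_ζ)))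

include P in
/-- `[X, Y] f = X Y f - Y X f`: a consequence of the Jacobi identity for `X`, `Y` and `f ζ`,
as `ζ` has no zeros. -/
lemma dirDeriv_bracket (hX : IsSmoothField X) (hY : IsSmoothField Y)
    (hf : ContMDiff (𝓡 (2 * n + 1)) 𝓘(ℝ, ℝ) ∞ f) (x : M) :
    dirDeriv (bracket X Y) f x = dirDeriv X (dirDeriv Y f) x - dirDeriv Y (dirDeriv X f) x := by
  have key {U V : VField (2 * n + 1) M} (hU : IsSmoothField U) (hV : IsSmoothField V) :
      bracket U (bracket V (f • P.ζ)) x = dirDeriv U (dirDeriv V f) x • P.ζ x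
        + dirDeriv V f x • bracket U P.ζ x + dirDeriv U f x • bracket V P.ζ x
        + f x • bracket U (bracket V P.ζ) x := by
    have h : bracket V (f • P.ζ) = dirDeriv V f • P.ζ + f • bracket V P.ζ :=
      funext fun y ↦ bracket_smul hf P.smooth_ζ y
    have hd := P.dirDeriv_contMDiff hV hf
    have hb := hV.bracket P.smooth_ζ
    rw [h, bracket_add (P.smooth_ζ.smul hd) (hb.smul hf), bracket_smul hd P.smooth_ζ,
      bracket_smul hf hb]
    abel
  have hJ := bracket_jacobi hX hY (P.smooth_ζ.smul hf) x
  have hJ' := bracket_jacobi hX hY P.smooth_ζ x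
  rw [key hX hY, key hY hX, bracket_smul hf P.smooth_ζ, hJ'] at hJ
  have h0 : (dirDeriv (bracket X Y) f x
      - (dirDeriv X (dirDeriv Y f) x - dirDeriv Y (dirDeriv X f) x)) • P.ζ x = 0 := by
    linear_combination (norm := module) -hJ
  exact sub_eq_zero.1 ((smul_eq_zero.1 h0).resolve_right (P.ζ_ne_zero x))

lemma dEta_contMDiff (hX : IsSmoothField X) (hY : IsSmoothField Y) :
    ContMDiff (𝓡 (2 * n + 1)) 𝓘(ℝ, ℝ) ∞ (P.dEta X Y) :=
  contMDiff_const.mul (((P.dirDeriv_contMDiff hX (P.eta_contMDiff hY)).sub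
    (P.dirDeriv_contMDiff hY (P.eta_contMDiff hX))).sub (P.eta_contMDiff (hX.bracket hY)))

variable {P} {g : SemiRiemannianMetric (2 * n + 1) M}

namespace IsMetric

variable (hg : P.IsMetric g)
include hg

lemma inner_ζ (x : M) (v : TangentSpace (𝓡 (2 * n + 1)) x) :
    g.inner x v (P.ζ x) = P.η x v := by
  have h := hg x v (P.ζ x)
  rw [P.φ_ζ, map_zero, P.η_ζ] at h
  linarith

lemma inner_φ_left (x : M) (v w : TangentSpace (𝓡 (2 * n + 1)) x) :
    g.inner x (P.φ x v) w = - g.inner x v (P.φ x w) := by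
  have h := hg x v (P.φ x w)
  simpa [P.φ_sq, P.η_φ, hg.inner_ζ] using h

end IsMetric

namespace IsParacontactMetric

variable (hP : P.IsParacontactMetric g)
include hP

lemma dEta_ζ_left (hX : IsSmoothField X) (x : M) : P.dEta P.ζ X x = 0 := by
  rw [hP.dEta_eq _ _ P.smooth_ζ hX, SemiRiemannianMetric.pair, g.symm, hP.isMetric.inner_ζ]
  exact P.η_φ x (X x)

/-- `£_ζ η = 0`. -/
lemma eta_bracket_ζ (hX : IsSmoothField X) (x : M) :
    P.eta (bracket P.ζ X) x = dirDeriv P.ζ (P.eta X) x := by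
  have h := hP.dEta_ζ_left hX x
  rw [dEta, P.eta_ζ, dirDeriv_const] at h
  linarith

/-- `£_ζ dη = 0`. -/
lemma dirDeriv_ζ_dEta (hX : IsSmoothField X) (hY : IsSmoothField Y) (x : M) :
    dirDeriv P.ζ (P.dEta X Y) x
      = P.dEta (bracket P.ζ X) Y x + P.dEta X (bracket P.ζ Y) x := by
  have hζ := P.smooth_ζ
  have h1 := P.dirDeriv_contMDiff hX (P.eta_contMDiff hY)
  have h2 := P.dirDeriv_contMDiff hY (P.eta_contMDiff hX)
  have h3 := P.eta_contMDiff (hX.bracket hY)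
  have hd : dirDeriv P.ζ (P.dEta X Y) x = (1 / 2) * (dirDeriv P.ζ (dirDeriv X (P.eta Y)) x
      - dirDeriv P.ζ (dirDeriv Y (P.eta X)) x - dirDeriv P.ζ (P.eta (bracket X Y)) x) := by
    have := dirDeriv_mul P.ζ (contMDiff_const (c := (1 / 2 : ℝ))) ((h1.sub h2).sub h3) x
    rw [dirDeriv_const, mul_zero, add_zero] at this
    refine this.trans ?_
    congr 1
    refine (dirDeriv_sub P.ζ (h1.sub h2) h3 x).trans ?_
    congr 1
    exact dirDeriv_sub P.ζ h1 h2 x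
  have e1 {Z : VField (2 * n + 1) M} (hZ : IsSmoothField Z) :
      dirDeriv P.ζ (P.eta Z) = P.eta (bracket P.ζ Z) :=
    funext fun y ↦ (hP.eta_bracket_ζ hZ y).symm
  have hX' := P.dirDeriv_bracket hζ hX (P.eta_contMDiff hY) x
  have hY' := P.dirDeriv_bracket hζ hY (P.eta_contMDiff hX) x
  rw [e1 hY] at hX'
  rw [e1 hX] at hY'
  have hJ : P.eta (bracket P.ζ (bracket X Y)) x = P.eta (bracket (bracket P.ζ X) Y) x
      + P.eta (bracket X (bracket P.ζ Y)) x := by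
    simp only [eta]
    rw [bracket_jacobi hζ hX hY x, map_add]
  rw [hd, e1 (hX.bracket hY), hJ]
  simp only [dEta]
  linarith

lemma pair_eq (hX : IsSmoothField X) (hY : IsSmoothField Y) (x : M) :
    g.pair X Y x = P.dEta X (P.phi Y) x + P.eta X x * P.eta Y x := by
  rw [hP.dEta_eq _ _ hX (P.phi_smooth hY)]
  simp [SemiRiemannianMetric.pair, phi, P.φ_sq, hP.isMetric.inner_ζ, eta, mul_comm]

end IsParacontactMetric

namespace IsParaSasakian

variable (hP : P.IsParaSasakian g)
include hP

/-- `£_ζ φ = 0`. -/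
lemma bracket_ζ_phi (hX : IsSmoothField X) (x : M) :
    bracket P.ζ (P.phi X) x = P.phi (bracket P.ζ X) x := by
  have h := hP.isNormal _ _ P.smooth_ζ hX x
  rw [hP.dEta_ζ_left hX, mul_zero, zero_smul, sub_zero] at h
  simp only [torsion, P.phi_ζ, bracket, VectorField.mlieBracket_zero_left] at h
  have h' : P.φ x (P.phi (bracket P.ζ X) x - bracket P.ζ (P.phi X) x) = 0 := by
    simpa [phi] using h
  have hη : P.η x (P.phi (bracket P.ζ X) x - bracket P.ζ (P.phi X) x) = 0 := by
    have := hP.eta_bracket_ζ (P.phi_smooth hX) x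
    rw [P.eta_phi, dirDeriv_const] at this
    rw [map_sub, show P.η x (bracket P.ζ (P.phi X) x) = 0 from this, sub_zero]
    exact P.η_φ x _
  have h2 := P.φ_sq x (P.phi (bracket P.ζ X) x - bracket P.ζ (P.phi X) x)
  rw [h', map_zero, hη, zero_smul, sub_zero, eq_comm, sub_eq_zero] at h2
  exact h2.symm

/-- The characteristic field of a para-Sasakian manifold is Killing. -/
lemma lieDeriv_ζ (hX : IsSmoothField X) (hY : IsSmoothField Y) (x : M) :
    g.lieDeriv P.ζ X Y x = 0 := by
  have hζ := P.smooth_ζ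
  have h : g.pair X Y = fun y ↦ P.dEta X (P.phi Y) y + P.eta X y * P.eta Y y :=
    funext fun y ↦ hP.pair_eq hX hY y
  have hb : bracket P.ζ (P.phi Y) = P.phi (bracket P.ζ Y) := funext (hP.bracket_ζ_phi hY)
  rw [SemiRiemannianMetric.lieDeriv, hP.pair_eq (hζ.bracket hX) hY,
    hP.pair_eq hX (hζ.bracket hY), h,
    dirDeriv_add _ (P.dEta_contMDiff hX (P.phi_smooth hY))
      (f' := fun y ↦ P.eta X y * P.eta Y y) ((P.eta_contMDiff hX).mul (P.eta_contMDiff hY)),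
    dirDeriv_mul _ (P.eta_contMDiff hX) (P.eta_contMDiff hY),
    hP.dirDeriv_ζ_dEta hX (P.phi_smooth hY), hb, hP.eta_bracket_ζ hX, hP.eta_bracket_ζ hY]
  ring

lemma nabla_ζ [T2Space M] (hX : IsSmoothField X) : g.nabla X P.ζ = -P.phi X := by
  funext x
  refine g.nabla_eq_of_koszul fun Z hZ ↦ ?_
  have hL := hP.lieDeriv_ζ hX hZ x
  have hd := hP.dEta_eq X Z hX hZ x
  have e1 (V : VField (2 * n + 1) M) : g.pair V P.ζ = P.eta V :=
    funext fun y ↦ hP.isMetric.inner_ζ y (V y)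
  have e2 : g.pair P.ζ Z = P.eta Z := by
    rw [← e1]; exact funext fun y ↦ g.symm ..
  have e3 : g.pair (bracket X P.ζ) Z x = - g.pair (bracket P.ζ X) Z x := by
    simp [SemiRiemannianMetric.pair, bracket_swap X P.ζ x]
  have e4 : g.pair (bracket P.ζ Z) X x = g.pair X (bracket P.ζ Z) x := g.symm ..
  have e5 : g.inner x ((-P.phi X) x) (Z x) = g.pair X (P.phi Z) x := by
    simp [phi, hP.isMetric.inner_φ_left, SemiRiemannianMetric.pair]
  rw [e5, ← hd, SemiRiemannianMetric.koszul, e1, e1, e2, e3, e4, dEta]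
  rw [SemiRiemannianMetric.lieDeriv] at hL
  linarith

/-- `R(X, ζ)ζ = -φ²X = -X + η(X)ζ`. -/
lemma curvature_ζ_ζ [T2Space M] (hX : IsSmoothField X) (x : M) :
    g.curvature X P.ζ P.ζ x = P.eta X x • P.ζ x - X x := by
  have hζ := P.smooth_ζ
  have h0 : g.nabla P.ζ P.ζ = 0 := by rw [hP.nabla_ζ hζ, P.phi_ζ, neg_zero]
  have hφ := P.phi_smooth hX
  have h1 : g.nabla P.ζ (g.nabla X P.ζ) x = P.phi (P.phi X) x - P.phi (bracket P.ζ X) x := by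
    rw [hP.nabla_ζ hX, g.nabla_eq_add_bracket, hP.nabla_ζ hφ.neg, bracket_neg hφ,
      hP.bracket_ζ_phi hX]
    simp [phi, sub_eq_add_neg]
  have h2 : g.nabla (bracket X P.ζ) P.ζ x = P.phi (bracket P.ζ X) x := by
    rw [hP.nabla_ζ (hX.bracket hζ)]
    simp [phi, bracket_swap X P.ζ x]
  simp only [SemiRiemannianMetric.curvature, Pi.sub_apply]
  rw [h0, g.nabla_zero_right, h1, h2]
  simp only [phi, P.φ_sq, eta, Pi.zero_apply]
  abel

/-- `S(ζ, ζ) = -2n`. -/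
lemma ricci_ζ_ζ [T2Space M] (x : M) : g.ricci P.ζ P.ζ x = -2 * (n : ℝ) := by
  have h (i : Fin (2 * n + 1)) : g.curvature (coordField x i) P.ζ P.ζ x
      = P.η x (coordBasis x i) • P.ζ x - coordBasis x i := by
    obtain ⟨X, hX, hXi⟩ := exists_smooth_eventuallyEq_coordField x i
    rw [← g.curvature_congr hXi (EventuallyEq.refl _ P.ζ) (EventuallyEq.refl _ P.ζ),
      hP.curvature_ζ_ζ hX, eta, hXi.eq_of_nhds, coordField_self]
  have hs : ∑ i, P.η x (coordBasis x i) * (coordBasis x).repr (P.ζ x) i = 1 := by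
    have := congrArg (P.η x) ((coordBasis x).sum_repr (P.ζ x))
    rw [P.η_ζ, map_sum] at this
    simpa [mul_comm] using this
  simp only [SemiRiemannianMetric.ricci, h, map_sub, map_smul, Finsupp.sub_apply,
    Finsupp.smul_apply, Basis.repr_self, Finsupp.single_eq_same, smul_eq_mul,
    Finset.sum_sub_distrib, hs]
  simp

end IsParaSasakian

end AlmostParacontact

end ParaGeom

end

theorem theorem5p1 (n : ℕ) {M : Type*} [TopologicalSpace M] [T2Space M]
    [ChartedSpace (EuclideanSpace ℝ (Fin (2 * n + 1))) M]
    [IsManifold (𝓡 (2 * n + 1)) ∞ M]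
    (P : ParaGeom.AlmostParacontact n M)
    (g : ParaGeom.SemiRiemannianMetric (2 * n + 1) M)
    (hP : P.IsParaSasakian g)
    (h lam : M → ℝ) (α β : ℝ)
    (hsol : g.IsProperHAlmostRicciYamabeSoliton P.ζ h lam α β) :
    g.IsEinsteinWith (-2 * (n : ℝ)) ∧
      ∀ x : M, β * g.scalar x = 2 * lam x - 4 * (n : ℝ) * α := by
  have hζ := P.smooth_ζ
  have hr (x : M) : β * g.scalar x = 2 * lam x - 4 * (n : ℝ) * α := by
    have h1 := hsol.soliton_eq _ _ hζ hζ x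
    have h2 : g.pair P.ζ P.ζ x = 1 := (hP.isMetric.inner_ζ x _).trans (P.η_ζ x)
    rw [hP.lieDeriv_ζ hζ hζ, hP.ricci_ζ_ζ, h2] at h1
    linarith
  refine ⟨fun X Y hX hY x ↦ ?_, hr⟩
  have h1 := hsol.soliton_eq X Y hX hY x
  rw [hP.lieDeriv_ζ hX hY] at h1
  refine mul_left_cancel₀ hsol.ne_zero ?_
  linear_combination h1 + (g.pair X Y x / 2) * hr x
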